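/- Let $p,q:\mathbb R^D\to(0,\infty)$ be continuously differentiable, everywhere positive probability densities, with $q(x)\to 0$ as $\|x\|\to\infty$. Let $s_p=\nabla\log p$, $s_q=\nabla\log q$ be their scores, write $s_p^r(x)=s_p(x)^{T}r$, and assume that for every $r\in\mathbb S^{D-1}$ $$\int_{\mathbb R^D} q\,|(s_p-s_q)^{T}r|\,dx<\infty ,\qquad \int_{\mathbb R^D} q\,|(s_p-s_q)^{T}r|^2\,dx<\infty .$$ Let $O_r$ be an orthonormal basis of $\mathbb R^D$. For every $r\in O_r$ and $g\in\mathbb S^{D-1}$ let $\mathcal H_{rg}$ be a reproducing kernel Hilbert space of functions $\mathbb R\to\mathbb R$ with kernel $k_{rg}$, such that: (i) $k_{rg}$ is $C_0$-universal, i.e. $\mathcal H_{rg}$ is contained in $C_0(\mathbb R)$ and is dense in it for the uniform norm; (ii) the kernel $k(x,x')=k_{rg}(x^{T}g,x'^{T}g)$ on $\mathbb R^D$ is in the Stein class of $q$, i.e. it has continuous second order partial derivatives, and for each fixed value of one argument the function $f$ of the other argument is continuously differentiable with $\nabla(fq)$ integrable and $\int_{\mathbb R^D}\nabla(fq)\,dx=0$;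 (iii) $\sup_x k_{rg}(x^{T}g,x^{T}g)<\infty$; (iv) $\mathbb E_{x\sim q}[h_{p,r,g}(x,x)]<\infty$, where, with $s=x^{T}g$ and $t=y^{T}g$, $$h_{p,r,g}(x,y)=s_p^r(x)\,k_{rg}(s,t)\,s_p^r(y)+r^{T}g\,s_p^r(y)\,\partial_s k_{rg}(s,t)+r^{T}g\,s_p^r(x)\,\partial_t k_{rg}(s,t)+(r^{T}g)^2\,\partial_s\partial_t k_{rg}(s,t).$$ Define $$D^2_{rg}(q,p)=\Big(\sup_{f\in\mathcal H_{rg},\,\|f\|\le 1}\mathbb E_{x\sim q}\big[s_p^r(x)f(x^{T}g)+r^{T}g\,f'(x^{T}g)\big]\Big)^2,\qquad SK_{\max}(q,p)=\sum_{r\in O_r}\ \sup_{g\in\mathbb S^{D-1}}D^2_{rg}(q,p)\in[0,\infty].$$ Then $SK_{\max}(q,p)=0$ if and only if $p=q$ almost everywhere. -/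

import Mathlib

noncomputable section

open MeasureTheory Filter Topology

namespace SKSD

/-- The Euclidean space `ℝ^D`. -/
abbrev Eucl (D : ℕ) : Type := EuclideanSpace ℝ (Fin D)

/-- The unit sphere `𝕊^{D-1}` of `ℝ^D`. -/
abbrev Sph (D : ℕ) : Type := Metric.sphere (0 : Eucl D) 1

/-- A continuously differentiable probability density supported on all of `ℝ^D`
(everywhere positive, so that its score is defined everywhere). -/
structure IsC1Density {D : ℕ} (p : Eucl D → ℝ) : Prop where
  pos : ∀ x, 0 < p x
  contDiff : ContDiff ℝ 1 p
  integrable : Integrable p volume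
  integral_eq_one : ∫ x, p x = 1

/-- The score `s_p(x) = ∇ log p(x)`. -/
def score {D : ℕ} (p : Eucl D → ℝ) (x : Eucl D) : Eucl D :=
  gradient (fun z => Real.log (p z)) x

/-- The projected score `s_p^r(x) = s_p(x)ᵀ r`. -/
def projScore {D : ℕ} (p : Eucl D → ℝ) (r x : Eucl D) : ℝ :=
  inner ℝ (score p x) r

/-- The expectation `𝔼_q[φ(x)]` for a density `q`. -/
def expect {D : ℕ} (q : Eucl D → ℝ) (φ : Eucl D → ℝ) : ℝ :=
  ∫ x, q x * φ x

/-- The Stein class of `q`: `∫ ∇(f q) dx = 0`, the integral being absolutely convergent. -/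
structure InSteinClass {D : ℕ} (q f : Eucl D → ℝ) : Prop where
  contDiff : ContDiff ℝ 1 f
  integrable : Integrable (fun x => gradient (fun z => f z * q z) x) volume
  integral_eq_zero : ∫ x, gradient (fun z => f z * q z) x = 0

/-- A kernel on `ℝ^D` in the Stein class of `q`: it has continuous second order partial
derivatives, and all its sections, in either argument, lie in the Stein class of `q`. -/
structure KernelInSteinClass {D : ℕ} (q : Eucl D → ℝ) (k : Eucl D → Eucl D → ℝ) : Prop where
  contDiff : ContDiff ℝ 2 (fun z : Eucl D × Eucl D => k z.1 z.2)
  left : ∀ x, InSteinClass q (fun y => k x y)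
  right : ∀ x, InSteinClass q (fun y => k y x)

section RKHSDefs

variable (H : Type*) [NormedAddCommGroup H] [InnerProductSpace ℝ H] [RKHS ℝ H ℝ ℝ]

/-- `C₀`-universality of (the kernel of) a reproducing kernel Hilbert space of real functions on
`ℝ`: its elements are continuous functions vanishing at infinity, and they are uniformly dense in
`C₀(ℝ)`. -/
structure IsC0Universal : Prop where
  continuous : ∀ f : H, Continuous f
  zero_at_infty : ∀ f : H, Tendsto f (cocompact ℝ) (𝓝 0)
  dense : ∀ φ : ZeroAtInftyContinuousMap ℝ ℝ, ∀ ε > 0, ∃ f : H, ∀ t, |f t - φ t| ≤ ε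

/-- The reproducing kernel, as a real function `k(s, t)` on `ℝ × ℝ`. -/
def ker [CompleteSpace H] (s t : ℝ) : ℝ := RKHS.kernel H s t 1

end RKHSDefs

/-- The kernel `k(x, y) = κ(xᵀg, yᵀg)` on `ℝ^D` induced by a kernel `κ` on `ℝ`. -/
def slicedKernel {D : ℕ} (κ : ℝ → ℝ → ℝ) (g x y : Eucl D) : ℝ :=
  κ (inner ℝ x g) (inner ℝ y g)

/-- `h_{p,r,g}(x, y)` for the one-dimensional kernel `κ`. -/
def steinKernel {D : ℕ} (κ : ℝ → ℝ → ℝ) (p : Eucl D → ℝ) (r g x y : Eucl D) : ℝ :=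
  projScore p r x * κ (inner ℝ x g) (inner ℝ y g) * projScore p r y
    + inner ℝ r g * projScore p r y * deriv (fun s => κ s (inner ℝ y g)) (inner ℝ x g)
    + inner ℝ r g * projScore p r x * deriv (fun t => κ (inner ℝ x g) t) (inner ℝ y g)
    + (inner ℝ r g) ^ 2 *
      deriv (fun s => deriv (fun t => κ s t) (inner ℝ y g)) (inner ℝ x g)

/-- The sliced Stein operator
`s_p^r(x) f(xᵀg) + rᵀg f'(xᵀg)` applied to `f : ℝ → ℝ`. -/
def slicedStein {D : ℕ} (p : Eucl D → ℝ) (r g : Eucl D) (f : ℝ → ℝ) (x : Eucl D) : ℝ :=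
  projScore p r x * f (inner ℝ x g) + inner ℝ r g * deriv f (inner ℝ x g)

/-- `D²_{rg}(q, p)`: the square of the supremum, over the unit ball of the reproducing kernel
Hilbert space `H`, of `𝔼_q[s_p^r(x) f(xᵀg) + rᵀg f'(xᵀg)]`. The supremum is taken in the extended
reals; it is nonnegative, as `f = 0` is admissible. -/
def discSq {D : ℕ} (H : Type*) [NormedAddCommGroup H] [InnerProductSpace ℝ H]
    [RKHS ℝ H ℝ ℝ] (q p : Eucl D → ℝ) (r g : Eucl D) : ENNReal :=
  (⨆ f : {f : H // ‖f‖ ≤ 1},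
    ((expect q (slicedStein p r g (f : H)) : ℝ) : EReal)).toENNReal ^ 2

/-- `SK_max(q, p) = ∑_{r ∈ O_r} sup_{g ∈ 𝕊^{D-1}} D²_{rg}(q, p)`, a value in `[0, ∞]`. -/
def maxSKSD {D : ℕ} (O : OrthonormalBasis (Fin D) ℝ (Eucl D)) (H : Fin D → Sph D → Type*)
    [∀ i g, NormedAddCommGroup (H i g)] [∀ i g, InnerProductSpace ℝ (H i g)]
    [∀ i g, RKHS ℝ (H i g) ℝ ℝ] (q p : Eucl D → ℝ) : ENNReal :=
  ∑ i, ⨆ g : Sph D, discSq (H i g) q p (O i) (g : Eucl D)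

end SKSD

end

/-!
The kernel `k` is the Gram kernel of the feature map `s ↦ k(s, ·)`, so a `C²` kernel has a
differentiable feature map and the sliced Stein operator at `x` is represented by a vector `ξ_p(x)`
of the reproducing kernel Hilbert space. Since `h_{p,r,g}(x, x) = ‖ξ_p(x)‖²`, the Bochner integral
`W = ∫ q ξ_p` exists, and `D²_{rg}(q, p) = ‖W‖²`. Stein's identity for `q` gives `∫ q ξ_q = 0`, so
that `W = ∫ q (s_p - s_q)ᵀr k(xᵀg, ·)`. If `W` vanishes for every `g`, universality of the kernels
shows that `q (s_p - s_q)ᵀr` integrates to zero against every ridge function `φ(xᵀg)` with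
`φ ∈ C₀(ℝ)`, hence is zero by the Cramér–Wold theorem. Letting `r` run through a basis, the scores
agree, so `p` and `q` are proportional, and both have integral one.
-/

noncomputable section

open MeasureTheory Filter Topology
open scoped ZeroAtInfty CompactlySupported

namespace SKSD

section Differentiability

theorem abs_mixed_difference_sub_le {k k₂ k₁₂ : ℝ → ℝ → ℝ} {S T : Set ℝ}
    (hS : Convex ℝ S) (hT : Convex ℝ T)
    (h₂ : ∀ s t, HasDerivAt (k s) (k₂ s t) t)
    (h₁₂ : ∀ s t, HasDerivAt (fun s => k₂ s t) (k₁₂ s t) s)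
    {c ε : ℝ} (hε : ∀ s ∈ S, ∀ t ∈ T, |k₁₂ s t - c| ≤ ε)
    {a b d e : ℝ} (ha : a ∈ S) (hb : b ∈ S) (hd : d ∈ T) (he : e ∈ T) :
    |k a d - k b d - (k a e - k b e) - c * (a - b) * (d - e)| ≤ ε * |a - b| * |d - e| := by
  have first_difference : ∀ t ∈ T, ‖k₂ a t - k₂ b t - c * (a - b)‖ ≤ ε * |a - b| := by
    intro t ht
    have := hS.norm_image_sub_le_of_norm_hasDerivWithin_le
      (f := fun s => k₂ s t - c * s) (f' := fun s => k₁₂ s t - c)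
      (fun s _ => by
        simpa using ((h₁₂ s t).fun_sub ((hasDerivAt_id' s).const_mul c)).hasDerivWithinAt)
      (fun s hs => hε s hs t ht) hb ha
    simp only [Real.norm_eq_abs] at this ⊢
    convert this using 2
    ring
  have := hT.norm_image_sub_le_of_norm_hasDerivWithin_le
    (f := fun t => k a t - k b t - c * (a - b) * t)
    (f' := fun t => k₂ a t - k₂ b t - c * (a - b))
    (fun t _ => by
      simpa using (((h₂ a t).fun_sub (h₂ b t)).fun_sub
        ((hasDerivAt_id' t).const_mul (c * (a - b)))).hasDerivWithinAt)
    first_difference he hd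
  simp only [Real.norm_eq_abs] at this
  convert this using 2
  ring

theorem exists_tendsto_mixed_slope_of_contDiff {k : ℝ → ℝ → ℝ}
    (hk : ContDiff ℝ 2 fun z : ℝ × ℝ => k z.1 z.2) (s t : ℝ) :
    ∃ c, Tendsto
      (fun z : ℝ × ℝ => (k z.1 z.2 - k s z.2 - (k z.1 t - k s t)) / ((z.1 - s) * (z.2 - t)))
      (𝓝[≠] s ×ˢ 𝓝[≠] t) (𝓝 c) := by
  set K : ℝ × ℝ → ℝ := fun z => k z.1 z.2
  set K₂ : ℝ × ℝ → ℝ := fun z => fderiv ℝ K z (0, 1)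
  set K₁₂ : ℝ × ℝ → ℝ := fun z => fderiv ℝ K₂ z (1, 0)
  have hK₂ : ContDiff ℝ 1 K₂ := (hk.fderiv_right (by norm_num)).clm_apply contDiff_const
  have hK₁₂ : Continuous K₁₂ := (hK₂.continuous_fderiv (by norm_num)).clm_apply continuous_const
  have h₂ : ∀ s t, HasDerivAt (k s) (K₂ (s, t)) t := fun s t =>
    (hk.differentiable (by norm_num) (s, t)).hasFDerivAt.comp_hasDerivAt t
      ((hasDerivAt_const t s).prodMk (hasDerivAt_id t))
  have h₁₂ : ∀ s t, HasDerivAt (fun s => K₂ (s, t)) (K₁₂ (s, t)) s := fun s t =>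
    (hK₂.differentiable (by norm_num) (s, t)).hasFDerivAt.comp_hasDerivAt (f := (·, t)) s
      ((hasDerivAt_id s).prodMk (hasDerivAt_const s t))
  refine ⟨K₁₂ (s, t), Metric.tendsto_nhds.2 fun ε hε => ?_⟩
  obtain ⟨δ, hδ, hK⟩ := Metric.continuousAt_iff.1 (hK₁₂.continuousAt (x := (s, t)))
    (ε / 2) (half_pos hε)
  have near : ∀ u : ℝ, ∀ᶠ v in 𝓝[≠] u, v ∈ Metric.ball u δ ∧ v ≠ u := fun u =>
    (eventually_nhdsWithin_of_eventually_nhds (Metric.ball_mem_nhds u hδ)).and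
      self_mem_nhdsWithin
  filter_upwards [(near s).prod_mk (near t)] with ⟨a, b⟩ ⟨⟨ha, has⟩, hb, hbt⟩
  have bound := abs_mixed_difference_sub_le (convex_ball s δ) (convex_ball t δ) h₂ h₁₂
    (fun u hu v hv => (hK (x := (u, v)) (by rw [Prod.dist_eq]; exact max_lt hu hv)).le)
    ha (Metric.mem_ball_self hδ) hb (Metric.mem_ball_self hδ)
  have hprod : (a - s) * (b - t) ≠ 0 := mul_ne_zero (sub_ne_zero.2 has) (sub_ne_zero.2 hbt)
  rw [Real.dist_eq, div_sub' hprod, abs_div, div_lt_iff₀ (abs_pos.2 hprod)]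
  calc |k a b - k s b - (k a t - k s t) - (a - s) * (b - t) * K₁₂ (s, t)|
      = |k a b - k s b - (k a t - k s t) - K₁₂ (s, t) * (a - s) * (b - t)| := by ring_nf
    _ ≤ ε / 2 * |(a - s) * (b - t)| := by rwa [abs_mul, ← mul_assoc]
    _ < ε * |(a - s) * (b - t)| := by
      have := abs_pos.2 hprod
      gcongr
      exact half_lt_self hε

variable {E : Type*} [NormedAddCommGroup E] [InnerProductSpace ℝ E]

theorem cauchy_map_of_tendsto_inner {ι : Type*} {l : Filter ι} [l.NeBot] {F : ι → E} {c : ℝ}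
    (h : Tendsto (fun z : ι × ι => (inner ℝ (F z.1) (F z.2) : ℝ)) (l ×ˢ l) (𝓝 c)) :
    Cauchy (map F l) := by
  have h_sq : Tendsto (fun z : ι × ι => ‖F z.1 - F z.2‖ ^ 2) (l ×ˢ l) (𝓝 0) := by
    have h_fst := h.comp ((tendsto_fst (f := l) (g := l)).prodMk tendsto_fst)
    have h_snd := h.comp ((tendsto_snd (f := l) (g := l)).prodMk tendsto_snd)
    convert (h_fst.sub (h.const_mul 2)).add h_snd using 2 with z
    · simp [norm_sub_sq_real]
    · ring
  have h_norm : Tendsto (fun z : ι × ι => ‖F z.1 - F z.2‖) (l ×ˢ l) (𝓝 0) := by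
    simpa using h_sq.sqrt
  rw [cauchy_map_iff, uniformity_eq_comap_nhds_zero, tendsto_comap_iff]
  exact ⟨inferInstance, tendsto_zero_iff_norm_tendsto_zero.2
    (by simpa only [Function.comp_def, norm_sub_rev] using h_norm)⟩

-- The inner product of two difference quotients of `Φ` is a mixed difference quotient of its Gram
-- kernel, so the difference quotients form a Cauchy filter.
theorem differentiable_of_contDiff_inner [CompleteSpace E] {Φ : ℝ → E}
    (hΦ : ContDiff ℝ 2 fun z : ℝ × ℝ => (inner ℝ (Φ z.1) (Φ z.2) : ℝ)) : Differentiable ℝ Φ := by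
  intro s
  obtain ⟨c, hc⟩ :=
    exists_tendsto_mixed_slope_of_contDiff (k := fun s t => inner ℝ (Φ s) (Φ t)) hΦ s s
  have h_inner : Tendsto (fun z : ℝ × ℝ => (inner ℝ (slope Φ s z.1) (slope Φ s z.2) : ℝ))
      (𝓝[≠] s ×ˢ 𝓝[≠] s) (𝓝 c) := by
    convert hc using 2 with z
    simp only [slope_def_module, real_inner_smul_left, real_inner_smul_right, inner_sub_left,
      inner_sub_right]
    field_simp
  obtain ⟨v, hv⟩ := cauchy_map_iff_exists_tendsto.1 (cauchy_map_of_tendsto_inner h_inner)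
  exact (hasDerivAt_iff_tendsto_slope.2 hv).differentiableAt

end Differentiability

section Separation

section General

variable {X : Type*} [MeasurableSpace X] {μ : Measure X} {w : X → ℝ}

theorem integral_withDensity_ofReal_sub (hw : AEMeasurable w μ) {f : X → ℝ}
    (hf : AEStronglyMeasurable f μ) (hwf : Integrable (fun x => w x * f x) μ) :
    ∫ x, f x ∂(μ.withDensity fun x => ENNReal.ofReal (w x))
      - ∫ x, f x ∂(μ.withDensity fun x => ENNReal.ofReal (-w x)) = ∫ x, w x * f x ∂μ := by
  have h_density : ∀ v : X → ℝ, AEMeasurable v μ →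
      ∫ x, f x ∂(μ.withDensity fun x => ENNReal.ofReal (v x)) = ∫ x, max (v x) 0 * f x ∂μ := by
    intro v hv
    rw [integral_withDensity_eq_integral_toReal_smul₀ hv.ennreal_ofReal (by simp)]
    simp [ENNReal.toReal_ofReal']
  have h_int : ∀ v : X → ℝ, AEMeasurable v μ → (∀ x, |v x| = |w x|) →
      Integrable (fun x => max (v x) 0 * f x) μ := by
    intro v hv hvw
    refine hwf.mono ((hv.max aemeasurable_const).aestronglyMeasurable.mul hf)
      (.of_forall fun x => ?_)
    rw [norm_mul, norm_mul, Real.norm_eq_abs, Real.norm_eq_abs (w x), ← hvw]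
    refine mul_le_mul_of_nonneg_right ?_ (norm_nonneg _)
    simpa using abs_max_le_max_abs_abs (a := v x) (b := 0)
  rw [h_density w hw, h_density (fun x => -w x) hw.neg, ← integral_sub (h_int w hw fun _ => rfl)
    (h_int (fun x => -w x) hw.neg fun x => abs_neg (w x))]
  refine integral_congr_ae (.of_forall fun x => ?_)
  simp only [← sub_mul, max_zero_sub_eq_self]

theorem ae_eq_zero_of_withDensity_ofReal_eq (hw : Integrable w μ)
    (h : μ.withDensity (fun x => ENNReal.ofReal (w x))
      = μ.withDensity fun x => ENNReal.ofReal (-w x)) : w =ᵐ[μ] 0 := by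
  have hae := (withDensity_eq_iff hw.aemeasurable.ennreal_ofReal hw.aemeasurable.neg.ennreal_ofReal
    hw.lintegral_lt_top.ne).1 h
  filter_upwards [hae] with x hx
  have := congrArg ENNReal.toReal hx
  simp only [ENNReal.toReal_ofReal'] at this
  simpa [this] using (max_zero_sub_eq_self (w x)).symm

theorem integrable_mul_zeroAtInfty {Y : Type*} [TopologicalSpace Y] [MeasurableSpace Y]
    [OpensMeasurableSpace Y] (hw : Integrable w μ) {T : X → Y} (hT : AEMeasurable T μ)
    (φ : C₀(Y, ℝ)) :
    Integrable (fun x => w x * φ (T x)) μ :=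
  hw.mul_bdd (c := ‖φ.toBCF‖) (φ.continuous.measurable.comp_aemeasurable hT).aestronglyMeasurable
    (.of_forall fun _ => φ.toBCF.norm_coe_le_norm _)

theorem continuous_integral_mul_zeroAtInfty {Y : Type*} [TopologicalSpace Y] [MeasurableSpace Y]
    [OpensMeasurableSpace Y] (hw : Integrable w μ) {T : X → Y} (hT : AEMeasurable T μ) :
    Continuous fun φ : C₀(Y, ℝ) => ∫ x, w x * φ (T x) ∂μ := by
  refine (LipschitzWith.of_dist_le' (K := ∫ x, ‖w x‖ ∂μ) fun φ ψ => ?_).continuous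
  rw [dist_eq_norm, ← integral_sub (integrable_mul_zeroAtInfty hw hT φ)
    (integrable_mul_zeroAtInfty hw hT ψ), ← integral_mul_const]
  refine norm_integral_le_of_norm_le (hw.norm.mul_const _) (.of_forall fun x => ?_)
  rw [← mul_sub, norm_mul, ← ZeroAtInftyContinuousMap.dist_toBCF_eq_dist, ← dist_eq_norm]
  gcongr
  exact BoundedContinuousFunction.dist_coe_le_dist (f := φ.toBCF) (g := ψ.toBCF) (T x)

theorem map_withDensity_ofReal_eq {T : X → ℝ} (hw : Integrable w μ) (hT : Measurable T)
    (h : ∀ φ : C₀(ℝ, ℝ), ∫ x, w x * φ (T x) ∂μ = 0) :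
    (μ.withDensity fun x => ENNReal.ofReal (w x)).map T
      = (μ.withDensity fun x => ENNReal.ofReal (-w x)).map T := by
  have : IsFiniteMeasure (μ.withDensity fun x => ENNReal.ofReal (w x)) :=
    isFiniteMeasure_withDensity_ofReal hw.2
  have : IsFiniteMeasure (μ.withDensity fun x => ENNReal.ofReal (-w x)) :=
    isFiniteMeasure_withDensity_ofReal hw.neg.2
  refine Measure.ext_of_integral_eq_on_compactlySupported fun f => ?_
  let φ : C₀(ℝ, ℝ) := ⟨f.toContinuousMap, f.hasCompactSupport.is_zero_at_infty⟩
  have hφ : Measurable φ := φ.continuous.measurable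
  rw [integral_map hT.aemeasurable (map_continuous f).aestronglyMeasurable,
    integral_map hT.aemeasurable (map_continuous f).aestronglyMeasurable, ← sub_eq_zero]
  exact (integral_withDensity_ofReal_sub hw.aemeasurable (hφ.comp hT).aestronglyMeasurable
    (integrable_mul_zeroAtInfty hw hT.aemeasurable φ)).trans (h φ)

end General

section Ridge

variable {E : Type*} [NormedAddCommGroup E] [InnerProductSpace ℝ E] [CompleteSpace E]
  [SecondCountableTopology E] [MeasurableSpace E] [BorelSpace E] [Nontrivial E]

theorem eq_of_map_inner_eq {μ ν : Measure E} [IsFiniteMeasure μ] [IsFiniteMeasure ν]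
    (h : ∀ g : E, ‖g‖ = 1 → μ.map (fun x => (inner ℝ x g : ℝ)) = ν.map fun x => inner ℝ x g) :
    μ = ν := by
  have charFun_smul : ∀ (ρ : Measure E) (g : E) (c : ℝ),
      charFun ρ (c • g) = charFun (ρ.map fun x => inner ℝ x g) c := by
    intro ρ g c
    rw [charFun_apply, charFun_apply_real, integral_map (by fun_prop) (by fun_prop)]
    simp [inner_smul_right]
  refine Measure.ext_of_charFun (funext fun ξ => ?_)
  obtain ⟨g, hg, c, rfl⟩ : ∃ g : E, ‖g‖ = 1 ∧ ∃ c : ℝ, ξ = c • g := by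
    rcases eq_or_ne ξ 0 with rfl | hξ
    · obtain ⟨g, hg⟩ := exists_norm_eq E zero_le_one
      exact ⟨g, hg, 0, by simp⟩
    · exact ⟨‖ξ‖⁻¹ • ξ, by simp [norm_smul, hξ], ‖ξ‖, by simp [smul_smul, hξ]⟩
  rw [charFun_smul, charFun_smul, h g hg]

theorem ae_eq_zero_of_integral_mul_ridge_eq_zero {μ : Measure E} {w : E → ℝ}
    (hw : Integrable w μ)
    (h : ∀ g : E, ‖g‖ = 1 → ∀ φ : C₀(ℝ, ℝ), ∫ x, w x * φ (inner ℝ x g) ∂μ = 0) :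
    w =ᵐ[μ] 0 := by
  have : IsFiniteMeasure (μ.withDensity fun x => ENNReal.ofReal (w x)) :=
    isFiniteMeasure_withDensity_ofReal hw.2
  have : IsFiniteMeasure (μ.withDensity fun x => ENNReal.ofReal (-w x)) :=
    isFiniteMeasure_withDensity_ofReal hw.neg.2
  exact ae_eq_zero_of_withDensity_ofReal_eq hw <| eq_of_map_inner_eq fun g hg =>
    map_withDensity_ofReal_eq hw (by fun_prop) (h g hg)

end Ridge

end Separation

section Feature

variable (H : Type*) [NormedAddCommGroup H] [InnerProductSpace ℝ H] [RKHS ℝ H ℝ ℝ]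
  [CompleteSpace H]

/-- The canonical feature map `s ↦ k(s, ·)` of a reproducing kernel Hilbert space on `ℝ`. -/
def feature (s : ℝ) : H := RKHS.kerFun H s (1 : ℝ)

variable {H} in
theorem inner_feature (s : ℝ) (f : H) : inner ℝ (feature H s) f = f s := by
  simp [feature]

theorem feature_apply (s t : ℝ) : feature H t s = ker H s t := by
  simp [feature, ker, RKHS.kerFun_apply]

theorem ker_eq_inner (s t : ℝ) : ker H s t = inner ℝ (feature H s) (feature H t) := by
  rw [inner_feature, feature_apply]

variable {H} {D : ℕ} {r g : Eucl D}

theorem contDiff_of_slicedKernel {κ : ℝ → ℝ → ℝ} {n : WithTop ℕ∞} (hg : ‖g‖ = 1)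
    (h : ContDiff ℝ n fun z : Eucl D × Eucl D => slicedKernel κ g z.1 z.2) :
    ContDiff ℝ n fun z : ℝ × ℝ => κ z.1 z.2 := by
  have := h.comp (f := fun z : ℝ × ℝ => (z.1 • g, z.2 • g)) (by fun_prop)
  convert this using 2 with z
  simp [slicedKernel, inner_smul_left, hg]

theorem KernelInSteinClass.differentiable_feature {q : Eucl D → ℝ}
    (hk : KernelInSteinClass q (slicedKernel (ker H) g)) (hg : ‖g‖ = 1) :
    Differentiable ℝ (feature H) :=
  differentiable_of_contDiff_inner
    (by simpa only [ker_eq_inner] using contDiff_of_slicedKernel hg hk.contDiff)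

theorem hasDerivAt_apply (hd : Differentiable ℝ (feature H)) (f : H) (s : ℝ) :
    HasDerivAt f (inner ℝ (deriv (feature H) s) f) s := by
  simpa [inner_feature] using (hd s).hasDerivAt.inner ℝ (hasDerivAt_const s f)

theorem deriv_ker_left (hd : Differentiable ℝ (feature H)) (s t : ℝ) :
    deriv (fun s => ker H s t) s = inner ℝ (deriv (feature H) s) (feature H t) := by
  simp only [← feature_apply]
  exact (hasDerivAt_apply hd (feature H t) s).deriv

theorem deriv_ker_right (hd : Differentiable ℝ (feature H)) (s t : ℝ) :
    deriv (fun t => ker H s t) t = inner ℝ (feature H s) (deriv (feature H) t) := by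
  rw [real_inner_comm, ← deriv_ker_left hd]
  simp only [ker_eq_inner, real_inner_comm]

theorem deriv_deriv_ker (hd : Differentiable ℝ (feature H)) (s t : ℝ) :
    deriv (fun s => deriv (fun t => ker H s t) t) s
      = inner ℝ (deriv (feature H) s) (deriv (feature H) t) := by
  simpa only [deriv_ker_right hd, inner_feature] using
    (hasDerivAt_apply hd (deriv (feature H) t) s).deriv

variable (H) in
/-- The element `s_p^r(x) k(xᵀg, ·) + rᵀg ∂k(xᵀg, ·)` of `H`, which represents the sliced Stein
operator at `x`. -/
def steinFeature (p : Eucl D → ℝ) (r g x : Eucl D) : H :=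
  projScore p r x • feature H (inner ℝ x g)
    + (inner ℝ r g : ℝ) • deriv (feature H) (inner ℝ x g)

theorem inner_steinFeature (hd : Differentiable ℝ (feature H)) (p : Eucl D → ℝ) (x : Eucl D)
    (f : H) : inner ℝ (steinFeature H p r g x) f = slicedStein p r g f x := by
  simp [slicedStein, steinFeature, (hasDerivAt_apply hd f _).deriv, inner_add_left,
    real_inner_smul_left, inner_feature]

theorem steinKernel_eq_inner (hd : Differentiable ℝ (feature H)) (p : Eucl D → ℝ)
    (x y : Eucl D) : steinKernel (ker H) p r g x y
      = inner ℝ (steinFeature H p r g x) (steinFeature H p r g y) := by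
  rw [steinKernel, deriv_deriv_ker hd, deriv_ker_left hd, deriv_ker_right hd, ker_eq_inner]
  simp only [steinFeature, inner_add_left, inner_add_right, real_inner_smul_left,
    real_inner_smul_right]
  ring

end Feature

section Universal

variable {H : Type*} [NormedAddCommGroup H] [InnerProductSpace ℝ H] [RKHS ℝ H ℝ ℝ]

/-- An element of `H`, as a function in `C₀(ℝ)`. -/
def IsC0Universal.toZeroAtInfty (hH : IsC0Universal H) (f : H) : C₀(ℝ, ℝ) :=
  ⟨⟨f, hH.continuous f⟩, hH.zero_at_infty f⟩

theorem IsC0Universal.denseRange_toZeroAtInfty (hH : IsC0Universal H) :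
    DenseRange hH.toZeroAtInfty := by
  refine Metric.denseRange_iff.2 fun φ ε hε => ?_
  obtain ⟨f, hf⟩ := hH.dense φ (ε / 2) (half_pos hε)
  refine ⟨f, lt_of_le_of_lt ?_ (half_lt_self hε)⟩
  rw [dist_comm, ← ZeroAtInftyContinuousMap.dist_toBCF_eq_dist]
  exact (BoundedContinuousFunction.dist_le (half_pos hε).le).2 hf

theorem IsC0Universal.integral_mul_zeroAtInfty_eq_zero (hH : IsC0Universal H) {X : Type*}
    [MeasurableSpace X] {μ : Measure X} {w : X → ℝ} (hw : Integrable w μ) {T : X → ℝ}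
    (hT : AEMeasurable T μ) (h : ∀ f : H, ∫ x, w x * f (T x) ∂μ = 0) (φ : C₀(ℝ, ℝ)) :
    ∫ x, w x * φ (T x) ∂μ = 0 :=
  congrFun (hH.denseRange_toZeroAtInfty.equalizer (continuous_integral_mul_zeroAtInfty hw hT)
    continuous_const (funext h)) φ

theorem IsC0Universal.exists_norm_feature_le [CompleteSpace H] (hH : IsC0Universal H) :
    ∃ B, ∀ t, ‖feature H t‖ ≤ B := by
  obtain ⟨B, hB⟩ := banach_steinhaus (g := fun t => innerSL ℝ (feature H t)) fun f =>
    ⟨‖(hH.toZeroAtInfty f).toBCF‖, fun t => by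
      rw [innerSL_apply_apply, inner_feature]
      exact (hH.toZeroAtInfty f).toBCF.norm_coe_le_norm t⟩
  exact ⟨B, fun t => by simpa using hB t⟩

theorem IsC0Universal.integrable_smul_feature [CompleteSpace H] (hH : IsC0Universal H)
    (hc : Continuous (feature H)) {X : Type*} [MeasurableSpace X] {μ : Measure X} {w : X → ℝ}
    (hw : Integrable w μ) {T : X → ℝ} (hT : Measurable T) :
    Integrable (fun x => w x • feature H (T x)) μ := by
  obtain ⟨B, hB⟩ := hH.exists_norm_feature_le
  exact hw.smul_bdd B (hc.stronglyMeasurable.comp_measurable hT).aestronglyMeasurable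
    (.of_forall fun x => hB (T x))

end Universal

section Density

variable {D : ℕ} {p q : Eucl D → ℝ}

theorem IsC1Density.contDiff_log (hp : IsC1Density p) : ContDiff ℝ 1 fun x => Real.log (p x) :=
  hp.contDiff.log fun x => (hp.pos x).ne'

theorem IsC1Density.continuous_score (hp : IsC1Density p) : Continuous (score p) :=
  (InnerProductSpace.toDual ℝ (Eucl D)).symm.continuous.comp
    (hp.contDiff_log.continuous_fderiv (by norm_num))

theorem IsC1Density.continuous_projScore (hp : IsC1Density p) (r : Eucl D) :
    Continuous (projScore p r) :=
  hp.continuous_score.inner continuous_const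

theorem IsC1Density.mul_projScore (hq : IsC1Density q) (r x : Eucl D) :
    q x * projScore q r x = fderiv ℝ q x r := by
  have hx := (hq.pos x).ne'
  rw [projScore, score, inner_gradient_left,
    ((hq.contDiff.differentiable (by norm_num) x).hasFDerivAt.log hx).fderiv]
  simp [hx]

theorem IsC1Density.mul_slicedStein (hq : IsC1Density q) (r g : Eucl D) {f : ℝ → ℝ}
    (hf : Differentiable ℝ f) (x : Eucl D) :
    q x * slicedStein q r g f x
      = inner ℝ r (gradient (fun z => f (inner ℝ z g) * q z) x) := by
  have h_ridge : HasFDerivAt (fun z : Eucl D => f (inner ℝ z g))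
      (deriv f (inner ℝ x g) • (innerSL ℝ).flip g) x :=
    (hf (inner ℝ x g)).hasDerivAt.comp_hasFDerivAt x ((innerSL ℝ).flip g).hasFDerivAt
  have h_prod := h_ridge.fun_mul (hq.contDiff.differentiable (by norm_num) x).hasFDerivAt
  rw [real_inner_comm, inner_gradient_left, h_prod.fderiv, slicedStein, mul_add, ← mul_assoc,
    hq.mul_projScore]
  simp only [add_apply, smul_apply, ContinuousLinearMap.flip_apply, innerSL_apply_apply,
    smul_eq_mul]
  ring

theorem IsC1Density.eq_of_score_eq (hp : IsC1Density p) (hq : IsC1Density q)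
    (h : score p = score q) : p = q := by
  have h_fderiv : ∀ x,
      fderiv ℝ (fun z => Real.log (p z)) x = fderiv ℝ (fun z => Real.log (q z)) x := fun x =>
    (InnerProductSpace.toDual ℝ (Eucl D)).symm.injective (congrFun h x)
  have h_const : ∀ x, Real.log (p x) - Real.log (q x) = Real.log (p 0) - Real.log (q 0) := by
    have hlp := hp.contDiff_log.differentiable (by norm_num)
    have hlq := hq.contDiff_log.differentiable (by norm_num)
    refine fun x => is_const_of_fderiv_eq_zero (hlp.fun_sub hlq) (fun x => ?_) x 0
    rw [fderiv_fun_sub (hlp x) (hlq x), h_fderiv, sub_self]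
  obtain ⟨c, h_ratio⟩ : ∃ c, ∀ x, p x = c * q x :=
    ⟨Real.exp (Real.log (p 0) - Real.log (q 0)), fun x => by
      rw [← h_const x, Real.exp_sub, Real.exp_log (hp.pos x), Real.exp_log (hq.pos x),
        div_mul_cancel₀ _ (hq.pos x).ne']⟩
  have h_one := hp.integral_eq_one
  simp only [h_ratio, integral_const_mul, hq.integral_eq_one, mul_one] at h_one
  funext x
  rw [h_ratio, h_one, one_mul]

/-- The function `q (s_p - s_q)ᵀ r`, against which the discrepancy integrates its test
functions. -/
def weightedScoreDiff (q p : Eucl D → ℝ) (r x : Eucl D) : ℝ :=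
  q x * inner ℝ (score p x - score q x) r

theorem continuous_weightedScoreDiff (hp : IsC1Density p) (hq : IsC1Density q) (r : Eucl D) :
    Continuous (weightedScoreDiff q p r) :=
  hq.contDiff.continuous.mul
    ((hp.continuous_score.sub hq.continuous_score).inner continuous_const)

theorem integrable_weightedScoreDiff (hp : IsC1Density p) (hq : IsC1Density q) {r : Eucl D}
    (h : Integrable fun x => q x * |inner ℝ (score p x - score q x) r|) :
    Integrable (weightedScoreDiff q p r) := by
  refine h.mono' (continuous_weightedScoreDiff hp hq r).aestronglyMeasurable
    (.of_forall fun x => ?_)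
  rw [weightedScoreDiff, norm_mul, Real.norm_of_nonneg (hq.pos x).le, Real.norm_eq_abs]

theorem IsC1Density.eq_of_weightedScoreDiff_eq_zero (hp : IsC1Density p) (hq : IsC1Density q)
    {ι : Type*} [Fintype ι] (O : OrthonormalBasis ι ℝ (Eucl D))
    (h : ∀ i, weightedScoreDiff q p (O i) = 0) : p = q := by
  refine hp.eq_of_score_eq hq (funext fun x => sub_eq_zero.1 ?_)
  refine InnerProductSpace.ext_inner_right_basis O.toBasis fun i => ?_
  simpa [weightedScoreDiff, (hq.pos x).ne'] using congrFun (h i) x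

end Density

section Witness

theorem integrable_smul_of_integrable_mul_norm_sq {X E : Type*} [MeasurableSpace X]
    {μ : Measure X} [NormedAddCommGroup E] [NormedSpace ℝ E] {q : X → ℝ} {ξ : X → E}
    (hq : ∀ x, 0 ≤ q x) (hq_int : Integrable q μ) (hξ : AEStronglyMeasurable ξ μ)
    (h : Integrable (fun x => q x * ‖ξ x‖ ^ 2) μ) : Integrable (fun x => q x • ξ x) μ := by
  refine (hq_int.add h).mono' (hq_int.aestronglyMeasurable.smul hξ) (.of_forall fun x => ?_)
  rw [norm_smul, Real.norm_of_nonneg (hq x), Pi.add_apply, ← mul_one_add]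
  gcongr
  · exact hq x
  · nlinarith [sq_nonneg (‖ξ x‖ - 1)]

theorem iSup_inner_unitBall_eq_norm {E : Type*} [NormedAddCommGroup E] [InnerProductSpace ℝ E]
    (v : E) : ⨆ f : {f : E // ‖f‖ ≤ 1}, ((inner ℝ v (f : E) : ℝ) : EReal) = (‖v‖ : ℝ) := by
  refine le_antisymm (iSup_le fun f => EReal.coe_le_coe_iff.2 ?_)
    (le_iSup_of_le ⟨‖v‖⁻¹ • v, ?_⟩ (EReal.coe_le_coe_iff.2 ?_))
  · exact (real_inner_le_norm v f).trans (mul_le_of_le_one_right (norm_nonneg v) f.2)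
  · rw [norm_smul, norm_inv, norm_norm]
    exact inv_mul_le_one
  · rw [real_inner_smul_right, real_inner_self_eq_norm_sq, sq, ← mul_assoc, mul_comm ‖v‖⁻¹,
      mul_inv_mul_cancel]

variable {D : ℕ} {p q : Eucl D → ℝ} {r g : Eucl D}
variable {H : Type*} [NormedAddCommGroup H] [InnerProductSpace ℝ H] [RKHS ℝ H ℝ ℝ]
  [CompleteSpace H]

variable (H) in
/-- The Riesz representer of the functional `f ↦ 𝔼_q[s_p^r(x) f(xᵀg) + rᵀg f'(xᵀg)]` on `H`,
whose norm is the discrepancy. -/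
def steinWitness (q p : Eucl D → ℝ) (r g : Eucl D) : H :=
  ∫ x, q x • steinFeature H p r g x

theorem stronglyMeasurable_steinFeature (hp : IsC1Density p)
    (hd : Differentiable ℝ (feature H)) (r g : Eucl D) :
    StronglyMeasurable (steinFeature H p r g) := by
  have h_proj : Continuous fun x : Eucl D => (inner ℝ x g : ℝ) := by fun_prop
  exact ((hp.continuous_projScore r).smul (hd.continuous.comp h_proj)).stronglyMeasurable.add
    (((stronglyMeasurable_deriv (feature H)).comp_measurable h_proj.measurable).const_smul _)

theorem integrable_smul_steinFeature (hp : IsC1Density p) (hq : IsC1Density q)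
    (hd : Differentiable ℝ (feature H))
    (hh : Integrable fun x => q x * steinKernel (ker H) p r g x x) :
    Integrable fun x => q x • steinFeature H p r g x := by
  refine integrable_smul_of_integrable_mul_norm_sq (fun x => (hq.pos x).le) hq.integrable
    (stronglyMeasurable_steinFeature hp hd r g).aestronglyMeasurable ?_
  simpa only [steinKernel_eq_inner hd, real_inner_self_eq_norm_sq] using hh

theorem expect_slicedStein (hd : Differentiable ℝ (feature H))
    (hp_int : Integrable fun x => q x • steinFeature H p r g x) (f : H) :
    expect q (slicedStein p r g f) = inner ℝ (steinWitness H q p r g) f := by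
  rw [steinWitness, real_inner_comm, ← integral_inner hp_int]
  simp only [expect, real_inner_comm _ f, real_inner_smul_left, inner_steinFeature hd]

theorem discSq_eq_enorm_sq (hd : Differentiable ℝ (feature H))
    (hp_int : Integrable fun x => q x • steinFeature H p r g x) :
    discSq H q p r g = ‖steinWitness H q p r g‖ₑ ^ 2 := by
  simp only [discSq, expect_slicedStein hd hp_int, iSup_inner_unitBall_eq_norm]
  rw [EReal.toENNReal_of_ne_top (EReal.coe_ne_top _), EReal.toReal_coe, ofReal_norm]

-- Pairing the witness with the kernel section at `t` gives its value at `t`, and this is Stein's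
-- identity for `q`.
theorem steinWitness_self (hq : IsC1Density q) (hg : ‖g‖ = 1)
    (hk : KernelInSteinClass q (slicedKernel (ker H) g))
    (hq_int : Integrable fun x => q x • steinFeature H q r g x) :
    steinWitness H q q r g = 0 := by
  have hd := hk.differentiable_feature hg
  refine RKHS.ext fun t => ?_
  have h_stein := hk.right (t • g)
  have h_section : ∀ y, slicedKernel (ker H) g y (t • g) = feature H t (inner ℝ y g) := fun y => by
    simp [feature_apply, slicedKernel, real_inner_smul_left, hg]
  have h_diff : Differentiable ℝ (feature H t) :=
    fun s => (hasDerivAt_apply hd (feature H t) s).differentiableAt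
  simp only [h_section] at h_stein
  rw [← inner_feature, real_inner_comm, ← expect_slicedStein hd hq_int, RKHS.coe_zero]
  simp only [expect, hq.mul_slicedStein r g h_diff]
  rw [integral_inner h_stein.integrable, h_stein.integral_eq_zero, inner_zero_right, Pi.zero_apply]

theorem smul_steinFeature_sub (q p : Eucl D → ℝ) (r g x : Eucl D) :
    q x • steinFeature H p r g x - q x • steinFeature H q r g x
      = weightedScoreDiff q p r x • feature H (inner ℝ x g) := by
  simp only [steinFeature, weightedScoreDiff, projScore, inner_sub_left]
  module

theorem steinWitness_eq_integral_smul_feature (hq : IsC1Density q) (hg : ‖g‖ = 1)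
    (hk : KernelInSteinClass q (slicedKernel (ker H) g)) (hH : IsC0Universal H)
    (hw : Integrable (weightedScoreDiff q p r))
    (hp_int : Integrable fun x => q x • steinFeature H p r g x) :
    steinWitness H q p r g = ∫ x, weightedScoreDiff q p r x • feature H (inner ℝ x g) := by
  have hw_int := hH.integrable_smul_feature (hk.differentiable_feature hg).continuous hw
    (T := fun x : Eucl D => inner ℝ x g) (by fun_prop)
  have hq_int : Integrable fun x => q x • steinFeature H q r g x := by
    simpa only [Pi.sub_def, ← smul_steinFeature_sub, sub_sub_cancel] using hp_int.sub hw_int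
  simp only [← smul_steinFeature_sub]
  rw [integral_sub hp_int hq_int, ← steinWitness, ← steinWitness,
    steinWitness_self hq hg hk hq_int, sub_zero]

theorem integral_weightedScoreDiff_mul_eq_zero (hq : IsC1Density q) (hg : ‖g‖ = 1)
    (hk : KernelInSteinClass q (slicedKernel (ker H) g)) (hH : IsC0Universal H)
    (hw : Integrable (weightedScoreDiff q p r))
    (hp_int : Integrable fun x => q x • steinFeature H p r g x)
    (h : steinWitness H q p r g = 0) (φ : C₀(ℝ, ℝ)) :
    ∫ x, weightedScoreDiff q p r x * φ (inner ℝ x g) = 0 := by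
  refine hH.integral_mul_zeroAtInfty_eq_zero hw (by fun_prop) (fun f => ?_) φ
  have hw_int := hH.integrable_smul_feature (hk.differentiable_feature hg).continuous hw
    (T := fun x : Eucl D => inner ℝ x g) (by fun_prop)
  calc ∫ x, weightedScoreDiff q p r x * f (inner ℝ x g)
      = ∫ x, inner ℝ f (weightedScoreDiff q p r x • feature H (inner ℝ x g)) := by
        simp only [real_inner_comm _ f, real_inner_smul_left, inner_feature]
    _ = inner ℝ f (steinWitness H q p r g) := by
        rw [integral_inner hw_int, steinWitness_eq_integral_smul_feature hq hg hk hH hw hp_int]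
    _ = 0 := by rw [h, inner_zero_right]

end Witness

end SKSD

theorem corollary2_general {D : ℕ}
    (p q : SKSD.Eucl D → ℝ)
    (hp : SKSD.IsC1Density p) (hq : SKSD.IsC1Density q)
    (O : OrthonormalBasis (Fin D) ℝ (SKSD.Eucl D))
    (hscore_L1 : ∀ i, Integrable
      fun x => q x * |inner ℝ (SKSD.score p x - SKSD.score q x) (O i)|)
    (H : Fin D → SKSD.Sph D → Type*)
    [∀ i g, NormedAddCommGroup (H i g)] [∀ i g, InnerProductSpace ℝ (H i g)]
    [∀ i g, CompleteSpace (H i g)] [∀ i g, RKHS ℝ (H i g) ℝ ℝ]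
    (hker_univ : ∀ i g, SKSD.IsC0Universal (H i g))
    (hker_stein : ∀ i g, SKSD.KernelInSteinClass q
      (SKSD.slicedKernel (SKSD.ker (H i g)) (g : SKSD.Eucl D)))
    (hh : ∀ i g, Integrable
      fun x => q x * SKSD.steinKernel (SKSD.ker (H i g)) p (O i) (g : SKSD.Eucl D) x x) :
    SKSD.maxSKSD O H q p = 0 ↔ p =ᵐ[volume] q := by
  have hg (g : SKSD.Sph D) : ‖(g : SKSD.Eucl D)‖ = 1 := norm_eq_of_mem_sphere g
  have hd i g := (hker_stein i g).differentiable_feature (hg g)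
  have hp_int i g := SKSD.integrable_smul_steinFeature hp hq (hd i g) (hh i g)
  have h_iff : SKSD.maxSKSD O H q p = 0 ↔ ∀ i g, SKSD.steinWitness (H i g) q p (O i) g = 0 := by
    simp [SKSD.maxSKSD, SKSD.discSq_eq_enorm_sq (hd _ _) (hp_int _ _)]
  rw [h_iff]
  constructor
  · intro h_witness
    have hw i := SKSD.integrable_weightedScoreDiff hp hq (hscore_L1 i)
    have h_score i : SKSD.weightedScoreDiff q p (O i) = 0 := by
      have : Nontrivial (SKSD.Eucl D) := ⟨O i, 0, O.orthonormal.ne_zero i⟩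
      have h_ae := SKSD.ae_eq_zero_of_integral_mul_ridge_eq_zero (hw i) fun g hg φ =>
        SKSD.integral_weightedScoreDiff_mul_eq_zero (g := g) hq hg
          (hker_stein i ⟨g, by simpa using hg⟩) (hker_univ i _) (hw i) (hp_int i _)
          (h_witness i _) φ
      exact ((SKSD.continuous_weightedScoreDiff hp hq (O i)).ae_eq_iff_eq volume
        continuous_zero).1 h_ae
    rw [hp.eq_of_weightedScoreDiff_eq_zero hq O h_score]
  · intro h_ae
    obtain rfl := (hp.contDiff.continuous.ae_eq_iff_eq volume hq.contDiff.continuous).1 h_ae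
    exact fun i g => SKSD.steinWitness_self hp (hg g) (hker_stein i g) (hp_int i g)

end

theorem corollary2 {D : ℕ}
    (p q : SKSD.Eucl D → ℝ)
    (hp : SKSD.IsC1Density p) (hq : SKSD.IsC1Density q)
    (hq_lim : Filter.Tendsto q (Filter.cocompact (SKSD.Eucl D)) (nhds 0))
    (hscore_L1 : ∀ r : SKSD.Sph D, MeasureTheory.Integrable
      (fun x => q x * |inner ℝ (SKSD.score p x - SKSD.score q x) (r : SKSD.Eucl D)|)
      MeasureTheory.volume)
    (hscore_L2 : ∀ r : SKSD.Sph D, MeasureTheory.Integrable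
      (fun x => q x * |inner ℝ (SKSD.score p x - SKSD.score q x) (r : SKSD.Eucl D)| ^ 2)
      MeasureTheory.volume)
    (O : OrthonormalBasis (Fin D) ℝ (SKSD.Eucl D))
    (H : Fin D → SKSD.Sph D → Type*)
    [∀ i g, NormedAddCommGroup (H i g)] [∀ i g, InnerProductSpace ℝ (H i g)]
    [∀ i g, CompleteSpace (H i g)] [∀ i g, RKHS ℝ (H i g) ℝ ℝ]
    (hker_univ : ∀ i g, SKSD.IsC0Universal (H i g))
    (hker_stein : ∀ i g, SKSD.KernelInSteinClass q
      (SKSD.slicedKernel (SKSD.ker (H i g)) (g : SKSD.Eucl D)))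
    (hker_bdd : ∀ i g, BddAbove (Set.range fun x : SKSD.Eucl D =>
      SKSD.slicedKernel (SKSD.ker (H i g)) (g : SKSD.Eucl D) x x))
    (hh : ∀ i g, MeasureTheory.Integrable
      (fun x => q x * SKSD.steinKernel (SKSD.ker (H i g)) p (O i) (g : SKSD.Eucl D) x x)
      MeasureTheory.volume) :
    SKSD.maxSKSD O H q p = 0 ↔ p =ᵐ[MeasureTheory.volume] q :=
  corollary2_general p q hp hq O (fun i => hscore_L1 ⟨O i, by simp⟩) H hker_univ hker_stein hh
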